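/- Let $\mathbb K=\mathbb R$ or $\mathbb C$ and let $(X,\tau)$ be a bornological locally convex Hausdorff space over $\mathbb K$. Suppose that $\widetilde\tau$ is a locally convex Hausdorff topology on $X$ such that * (BBCl) every $\tau$-bounded subset of $X$ is contained in an absolutely convex, $\tau$-bounded, $\widetilde\tau$-closed set, and * (CNC) $\tau$ has a $0$-neighbourhood basis consisting of absolutely convex $\widetilde\tau$-closed sets. Let $\widetilde\gamma$ denote the finest locally convex Hausdorff topology on $X$ which coincides with $\widetilde\tau$ on every $\tau$-bounded set. For a locally convex Hausdorff space $E$ let $E_b'$ denote its topological dual with the topology of uniform convergence on the bounded subsets of $E$; $E$ is called semi-reflexive if the canonical map $E\to (E_b')'$, $x\mapsto[x'\mapsto x'(x)]$, is surjective. Assume that $(X,\widetilde\gamma)$ is semi-reflexive and that * (B$\tau$B$\widetilde\gamma$) a subset of $X$ is $\tau$-bounded if and only if it is $\widetilde\gamma$-bounded. Then $(X,\widetilde\gamma)_b'$ is a complete barrelled locally convex Hausdorff space, and the evaluation map $$\mathcal I\colon (X,\tau)\to ((X,\widetilde\gamma)_b')_b',\qquad x\longmapsto [x'\mapsto x'(x)],$$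 is a well-defined topological isomorphism. In particular, $(X,\tau)$ is a bidual space with semi-reflexive prebidual $((X,\widetilde\gamma),\mathcal I)$; that is, $(X,\widetilde\gamma)$ is a semi-reflexive locally convex Hausdorff space and $\mathcal I$ is a topological isomorphism of $(X,\tau)$ onto its strong bidual. -/

import Mathlib

open Set Topology

namespace MixedDual

/-- The set `X` regarded as a topological space with topology `t`. -/
def SpaceWith (X : Type*) (_t : TopologicalSpace X) : Type _ := X

section SpaceWith

variable {X : Type*} (t : TopologicalSpace X)

instance : TopologicalSpace (SpaceWith X t) := t

instance [AddCommGroup X] : AddCommGroup (SpaceWith X t) := inferInstanceAs (AddCommGroup X)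

instance {R : Type*} [Semiring R] [AddCommGroup X] [Module R X] : Module R (SpaceWith X t) :=
  inferInstanceAs (Module R X)

end SpaceWith

section Topologies

variable (𝕜 : Type*) [RCLike 𝕜] {X : Type*} [AddCommGroup X] [Module 𝕜 X] [Module ℝ X]

/-- `t` is a locally convex Hausdorff (vector space) topology on `X`. -/
structure IsLCH (t : TopologicalSpace X) : Prop where
  isTopologicalAddGroup : @IsTopologicalAddGroup X t _
  continuousSMul : @ContinuousSMul 𝕜 X _ _ t
  locallyConvexSpace : @LocallyConvexSpace ℝ X _ _ _ _ t
  t2Space : @T2Space X t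

/-- `B` is a bounded subset of `(X, t)`. -/
def IsBdd (t : TopologicalSpace X) (B : Set X) : Prop :=
  @Bornology.IsVonNBounded 𝕜 X _ _ _ t B

/-- `U` is absolutely convex. -/
def IsAbsConvex (U : Set X) : Prop := Balanced 𝕜 U ∧ Convex ℝ U

/-- `(X, t)` is bornological: every absolutely convex set absorbing all bounded sets is a
`0`-neighbourhood. -/
def IsBornological (t : TopologicalSpace X) : Prop :=
  ∀ U : Set X, IsAbsConvex 𝕜 U → (∀ B : Set X, IsBdd 𝕜 t B → Absorbs 𝕜 U B) →
    U ∈ @nhds X t 0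

/-- Condition (BBCl) of `(X, τ)` for `τ'`. -/
def BBCl (τ τ' : TopologicalSpace X) : Prop :=
  ∀ B : Set X, IsBdd 𝕜 τ B →
    ∃ C : Set X, B ⊆ C ∧ IsAbsConvex 𝕜 C ∧ IsBdd 𝕜 τ C ∧ IsClosed[τ'] C

/-- Condition (CNC) of `(X, τ)` for `τ'`. -/
def CNC (τ τ' : TopologicalSpace X) : Prop :=
  (@nhds X τ 0).HasBasis
    (fun U : Set X => U ∈ @nhds X τ 0 ∧ IsAbsConvex 𝕜 U ∧ IsClosed[τ'] U) id

/-- The topology `γ` coincides with `τ'` on every `τ`-bounded set. -/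
def AgreeOnBdd (τ τ' γ : TopologicalSpace X) : Prop :=
  ∀ B : Set X, IsBdd 𝕜 τ B →
    TopologicalSpace.induced (Subtype.val : B → X) γ =
      TopologicalSpace.induced (Subtype.val : B → X) τ'

/-- The finest locally convex Hausdorff topology on `X` which coincides with `τ'` on `τ`-bounded
sets (in Mathlib's order on topologies, finer means smaller; see `isLeast_gammaTilde`). -/
def gammaTilde (τ τ' : TopologicalSpace X) : TopologicalSpace X :=
  sInf {γ | IsLCH 𝕜 γ ∧ AgreeOnBdd 𝕜 τ τ' γ}

/-- The topologies `τ` and `γ` have the same bounded sets. -/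
def SameBdd (τ γ : TopologicalSpace X) : Prop :=
  ∀ B : Set X, IsBdd 𝕜 τ B ↔ IsBdd 𝕜 γ B

theorem isLeast_gammaTilde (τ τ' : TopologicalSpace X) (h' : IsLCH 𝕜 τ') :
    IsLeast {γ | IsLCH 𝕜 γ ∧ AgreeOnBdd 𝕜 τ τ' γ} (gammaTilde 𝕜 τ τ') := by
  have hmem : τ' ∈ {γ | IsLCH 𝕜 γ ∧ AgreeOnBdd 𝕜 τ τ' γ} := ⟨h', fun _ _ => rfl⟩
  refine ⟨⟨⟨?_, ?_, ?_, ?_⟩, ?_⟩, fun γ hγ => sInf_le hγ⟩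
  · exact topologicalAddGroup_sInf fun γ hγ => hγ.1.1
  · exact continuousSMul_sInf fun γ hγ => hγ.1.2
  · exact LocallyConvexSpace.sInf fun γ hγ => hγ.1.3
  · exact @T2Space.of_injective_continuous X X (gammaTilde 𝕜 τ τ') τ' h'.4 id
      Function.injective_id (continuous_id_iff_le.2 (sInf_le hmem))
  · intro B hB
    rw [gammaTilde, sInf_eq_iInf, induced_iInf]
    refine le_antisymm ?_ ?_
    · refine (iInf_le _ τ').trans ?_
      rw [induced_iInf]
      exact iInf_le _ hmem
    · refine le_iInf fun γ => ?_
      rw [induced_iInf]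
      exact le_iInf fun hγ => (hγ.2 B hB).ge

instance (τ τ' : TopologicalSpace X) :
    ContinuousSMul 𝕜 (SpaceWith X (gammaTilde 𝕜 τ τ')) :=
  continuousSMul_sInf (M := 𝕜) (X := X) fun _ hγ => hγ.1.2

end Topologies

section Duals

/-! `StrongDual 𝕜 E` is Mathlib's continuous dual with the topology of uniform convergence on the
(von Neumann) bounded subsets of `E`. -/

variable (𝕜 : Type*) [RCLike 𝕜] (E : Type*) [AddCommGroup E] [Module 𝕜 E] [TopologicalSpace E]
  [ContinuousSMul 𝕜 E]

/-- The canonical map `x ↦ [f ↦ f x]` from `E` to its strong bidual. -/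
def evalBidual : E →ₗ[𝕜] StrongDual 𝕜 (StrongDual 𝕜 E) where
  toFun x :=
    { toFun := fun f => f x
      map_add' := fun _ _ => rfl
      map_smul' := fun _ _ => rfl
      cont := continuous_eval_const x }
  map_add' x y := by ext f; exact map_add f x y
  map_smul' c x := by ext f; exact map_smul f c x

/-- `E` is semi-reflexive. -/
def IsSemiReflexive : Prop := Function.Surjective (evalBidual 𝕜 E)

end Duals

section Prebidual

variable (𝕜 : Type*) [RCLike 𝕜] {X : Type*} [AddCommGroup X] [Module 𝕜 X] [Module ℝ X]

/-- `(Y, υ)` together with the linear map `φ` is a prebidual of `(X, τ)`: `(Y, υ)` is a locally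
convex Hausdorff space and `φ` is a topological isomorphism from `(X, τ)` onto the strong bidual
of `(Y, υ)`. -/
structure IsPrebidual (τ : TopologicalSpace X)
    {Y : Type*} [AddCommGroup Y] [Module 𝕜 Y] [Module ℝ Y] (υ : TopologicalSpace Y)
    (φ : SpaceWith X τ →ₗ[𝕜] StrongDual 𝕜 (StrongDual 𝕜 (SpaceWith Y υ))) : Prop where
  isLCH : IsLCH 𝕜 υ
  isHomeomorph : IsHomeomorph φ

/-- The evaluation map `x ↦ [f ↦ f x]` from `(X, τ)` to the strong bidual of
`(X, gammaTilde 𝕜 τ τ')`. -/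
def evalMixed (τ τ' : TopologicalSpace X) :
    SpaceWith X τ →ₗ[𝕜] StrongDual 𝕜 (StrongDual 𝕜 (SpaceWith X (gammaTilde 𝕜 τ τ'))) where
  toFun x := evalBidual 𝕜 (SpaceWith X (gammaTilde 𝕜 τ τ')) x
  map_add' := map_add (evalBidual 𝕜 (SpaceWith X (gammaTilde 𝕜 τ τ')))
  map_smul' := map_smul (evalBidual 𝕜 (SpaceWith X (gammaTilde 𝕜 τ τ')))

end Prebidual

end MixedDual

namespace MixedDual

open Bornology Filter

/-! Write γ for `gammaTilde 𝕜 τ τ'`. Everything rests on polarity between X and its γ-dual.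
Completeness: a limit, uniform on bounded sets, of γ-continuous functionals is linear and
γ-continuous on bounded sets; as γ is the finest topology of its kind, the limit is γ-continuous.
Barrelledness: the polar of a barrel is weakly bounded, hence bounded by Mackey's theorem
(Banach–Steinhaus for one seminorm at a time). By semi-reflexivity and Hahn–Banach the barrel
contains the polar of that polar, a neighbourhood of 0. Evaluation map: the preimage of a basic
neighbourhood is absolutely convex and absorbs bounded sets, so `IsBornological` gives continuity.
For openness, a `CNC` neighbourhood U is γ-closed and its polar is bounded in the dual, so the
bipolar argument recovers U. -/

/-- A set on which every continuous linear functional is bounded is bounded for every continuous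
seminorm. -/
theorem bddAbove_seminorm_image_of_forall_dual {𝕜 E : Type*} [RCLike 𝕜] [AddCommGroup E]
    [Module 𝕜 E] [TopologicalSpace E] [IsTopologicalAddGroup E] {A : Set E}
    (hA : ∀ f : StrongDual 𝕜 E, ∃ C, ∀ x ∈ A, ‖f x‖ ≤ C) {p : Seminorm 𝕜 E} (hp : Continuous p) :
    BddAbove (p '' A) := by
  -- A functional dominated by p is continuous for the original topology. So the points of A are
  -- pointwise bounded on the dual of E normed by p, a Banach space, and Banach–Steinhaus applies.
  have key : ∀ g : E →ₗ[𝕜] 𝕜, (∃ C, ∀ x, ‖g x‖ ≤ C * p x) → ∃ C, ∀ x ∈ A, ‖g x‖ ≤ C := by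
    rintro g ⟨C, hC⟩
    refine hA ⟨g, continuous_of_continuousAt_zero g ?_⟩
    rw [ContinuousAt, map_zero]
    refine squeeze_zero_norm hC ?_
    simpa using (hp.tendsto 0).const_mul C
  clear hA hp
  let : SeminormedAddCommGroup E := p.toAddGroupSeminorm.toSeminormedAddCommGroup
  let : NormedSpace 𝕜 E := ⟨fun c x => (map_smul_eq_mul p c x).le⟩
  obtain ⟨C, hC⟩ := banach_steinhaus (𝕜 := 𝕜)
    (g := fun x : A => NormedSpace.inclusionInDoubleDual 𝕜 E x) fun f => by
      obtain ⟨C, hC⟩ := key f ⟨‖f‖, f.le_opNorm⟩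
      exact ⟨C, fun x => hC x x.2⟩
  refine ⟨C, ?_⟩
  rintro _ ⟨x, hx, rfl⟩
  exact ((NormedSpace.inclusionInDoubleDualLi (E := E) 𝕜).norm_map x).symm.le.trans (hC ⟨x, hx⟩)

/-! ### Polars, Mackey's theorem, barrelledness -/

section LocallyConvex

variable {𝕜 E : Type*} [RCLike 𝕜] [AddCommGroup E] [Module 𝕜 E] [Module ℝ E] [IsScalarTower ℝ 𝕜 E]
  [TopologicalSpace E] [IsTopologicalAddGroup E] [ContinuousSMul 𝕜 E] [LocallyConvexSpace ℝ E]

/-- A point outside a closed absolutely convex set `C` is separated from `C` by an element of the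
polar of `C`. -/
theorem exists_polar_one_lt_norm {C : Set E} (hC : IsAbsConvex 𝕜 C) (hcl : IsClosed C)
    (h0 : (0 : E) ∈ C) {x : E} (hx : x ∉ C) :
    ∃ f : StrongDual 𝕜 E, (∀ y ∈ C, ‖f y‖ ≤ 1) ∧ 1 < ‖f x‖ := by
  obtain ⟨f, u, hf, hu⟩ :=
    RCLike.geometric_hahn_banach_closed_point (𝕜 := 𝕜) hC.2 hcl hx
  have hu0 : 0 < u := by simpa using hf 0 h0
  have hle : ∀ y ∈ C, ‖f y‖ ≤ u := by
    intro y hy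
    -- Rotating y by a unimodular scalar, which balancedness permits, turns a bound on the real part
    -- into one on the norm.
    obtain ⟨d, hd, hdy⟩ : ∃ d : 𝕜, ‖d‖ = 1 ∧ d * f y = (‖f y‖ : 𝕜) :=
      RCLike.exists_norm_eq_mul_self (f y) |>.imp fun d hd => ⟨hd.1, hd.2.symm⟩
    have hmem : d • y ∈ C := hC.1 d hd.le (Set.smul_mem_smul_set hy)
    have := hf _ hmem
    rw [map_smul, smul_eq_mul, hdy, RCLike.ofReal_re] at this
    exact this.le
  refine ⟨((u⁻¹ : ℝ) : 𝕜) • f, fun y hy => ?_, ?_⟩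
  · have := hle y hy
    rw [_root_.smul_apply, norm_smul, RCLike.norm_ofReal, abs_of_pos (inv_pos.2 hu0),
      inv_mul_le_iff₀ hu0]
    simpa using this
  · have := hu.trans_le ((RCLike.re_le_norm (f x)))
    rw [_root_.smul_apply, norm_smul, RCLike.norm_ofReal, abs_of_pos (inv_pos.2 hu0),
      lt_inv_mul_iff₀ hu0]
    simpa using this

/-- Mackey's theorem: a weakly bounded set is bounded. -/
theorem isVonNBounded_of_forall_dual {A : Set E}
    (hA : ∀ f : StrongDual 𝕜 E, ∃ C, ∀ x ∈ A, ‖f x‖ ≤ C) : IsVonNBounded 𝕜 A := by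
  have : ContinuousSMul ℝ E := IsScalarTower.continuousSMul 𝕜
  let : PartialOrder 𝕜 := RCLike.toPartialOrder
  have : IsStrictOrderedRing 𝕜 := RCLike.toIsStrictOrderedRing
  have : LocallyConvexSpace 𝕜 E := .ofBasisZero 𝕜 E _ _
    (LocallyConvexSpace.convex_basis_zero ℝ E) fun s hs =>
      convex_of_nonneg_surjective_algebraMap _
        (fun _ => RCLike.nonneg_iff_exists_ofReal.mp) hs.2
  rw [(PolynormableSpace.withSeminorms 𝕜 E).isVonNBounded_iff_seminorm_bddAbove]
  rintro ⟨p, hp⟩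
  exact bddAbove_seminorm_image_of_forall_dual hA hp

/-- The strong dual of a semi-reflexive locally convex space is barrelled. -/
theorem IsSemiReflexive.barrelledSpace_strongDual (h : IsSemiReflexive 𝕜 E) :
    BarrelledSpace 𝕜 (StrongDual 𝕜 E) where
  continuous_of_lowerSemicontinuous p hp := by
    have hcl : IsClosed (p.closedBall 0 1) := by
      rw [Seminorm.closedBall_zero_eq]
      exact hp.isClosed_preimage 1
    let A : Set E := {x | ∀ f : StrongDual 𝕜 E, p f ≤ 1 → ‖f x‖ ≤ 1}
    have hA : IsVonNBounded 𝕜 A := by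
      refine isVonNBounded_of_forall_dual fun f => ⟨p f + 1, fun x hx => ?_⟩
      -- Scaling by p f + 1 puts f in the barrel even if p f = 0.
      have hpos : 0 < p f + 1 := by positivity
      have hn : ‖(((p f + 1)⁻¹ : ℝ) : 𝕜)‖ = (p f + 1)⁻¹ := by
        rw [RCLike.norm_ofReal, abs_of_pos (inv_pos.2 hpos)]
      have := hx ((((p f + 1)⁻¹ : ℝ) : 𝕜) • f) (by
        rw [map_smul_eq_mul, hn, inv_mul_le_iff₀ hpos]; linarith)
      rwa [_root_.smul_apply, norm_smul, hn, inv_mul_le_iff₀ hpos, mul_one] at this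
    refine Seminorm.continuous' (r := 1) ?_
    have hnhds := ContinuousLinearMap.eventually_nhds_zero_mapsTo (σ := RingHom.id 𝕜) hA
      (Metric.closedBall_mem_nhds (0 : 𝕜) one_pos)
    refine mem_of_superset hnhds fun f hf => ?_
    by_contra hfp
    obtain ⟨φ, hφ, hφf⟩ := exists_polar_one_lt_norm (𝕜 := 𝕜)
      ⟨p.balanced_closedBall_zero 1, p.convex_closedBall 0 1⟩ hcl (by simp) hfp
    obtain ⟨x, rfl⟩ := h φ
    have hx : x ∈ A := fun g hg => hφ g (by simpa using hg)
    have : ‖f x‖ ≤ 1 := by simpa using hf hx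
    exact hφf.not_ge this

end LocallyConvex

/-! ### Completeness of the strong dual -/

section Complete

variable {𝕜 E : Type*} [RCLike 𝕜] [AddCommGroup E] [Module 𝕜 E]
  [TopologicalSpace E] [ContinuousSMul 𝕜 E]

/-- The strong dual is complete if every linear functional that is continuous on bounded sets is
continuous. -/
theorem completeSpace_strongDual
    (h : ∀ g : E →ₗ[𝕜] 𝕜, (∀ B, IsVonNBounded 𝕜 B → ContinuousOn g B) → Continuous g) :
    CompleteSpace (StrongDual 𝕜 E) := by
  let 𝔖 : Set (Set E) := {s | IsVonNBounded 𝕜 s}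
  have hemb := ContinuousLinearMap.isUniformEmbedding_toUniformOnFun (σ := RingHom.id 𝕜) (E := E)
    (F := 𝕜)
  rw [completeSpace_iff_isComplete_range hemb.isUniformInducing]
  apply IsClosed.isComplete
  have h₁ : IsClosed {f : UniformOnFun E 𝕜 𝔖 |
      ∀ B ∈ 𝔖, ContinuousOn (UniformOnFun.toFun 𝔖 f) B} := by
    refine isClosed_iff_forall_filter.2 fun f l hl hls hlf B hB => ?_
    have := UniformOnFun.tendsto_iff_tendstoUniformlyOn.1 (tendsto_id'.2 hlf) B hB
    exact this.continuousOn (Eventually.frequently (f := l)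
      (Eventually.mono (le_principal_iff.1 hls) fun g hg => hg B hB))
  have h₂ := (LinearMap.isClosed_range_coe E 𝕜 (RingHom.id 𝕜)).preimage
    (UniformOnFun.uniformContinuous_toFun (𝔖 := 𝔖) (β := 𝕜)
      sUnion_isVonNBounded_eq_univ).continuous
  refine (congrArg IsClosed (Set.ext fun f => ⟨?_, ?_⟩)).mpr (h₁.inter h₂)
  · rintro ⟨g, rfl⟩
    exact ⟨fun B _ => g.continuous.continuousOn, ⟨g.toLinearMap, rfl⟩⟩
  · rintro ⟨hf, g, hg⟩
    refine ⟨⟨g, h g fun B hB => ?_⟩, ?_⟩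
    · rw [hg]; exact hf B hB
    · exact hg

end Complete

section AddGroup

variable {G H : Type*} [AddCommGroup G] [TopologicalSpace G] [IsTopologicalAddGroup G]
  [AddCommGroup H] [TopologicalSpace H] [IsTopologicalAddGroup H] {f : G → H}

theorem continuous_of_map_add (hadd : ∀ x y, f (x + y) = f x + f y)
    (hf : Tendsto f (𝓝 0) (𝓝 0)) : Continuous f :=
  continuous_of_tendsto_nhds_zero (AddMonoidHom.mk' f hadd) hf

theorem isOpenMap_of_map_add (hadd : ∀ x y, f (x + y) = f x + f y)
    (hf : 𝓝 0 ≤ map f (𝓝 0)) : IsOpenMap f :=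
  (IsTopologicalAddGroup.isOpenMap_iff_nhds_zero (f := AddMonoidHom.mk' f hadd)).2 hf

end AddGroup

/-! ### The mixed topology and the evaluation map -/

section Mixed

variable {𝕜 : Type*} [RCLike 𝕜] {X : Type*} [AddCommGroup X] [Module 𝕜 X]
    [Module ℝ X] {τ τ' : TopologicalSpace X}

/-- A linear functional whose restrictions to the `τ`-bounded sets are continuous for
`gammaTilde 𝕜 τ τ'` is itself continuous for this topology. -/
theorem continuous_gammaTilde_of_continuousOn [IsScalarTower ℝ 𝕜 X] (hτ' : IsLCH 𝕜 τ')
    (g : X →ₗ[𝕜] 𝕜)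
    (hg : ∀ B, IsBdd 𝕜 τ B → @ContinuousOn X 𝕜 (gammaTilde 𝕜 τ τ') _ g B) :
    Continuous[gammaTilde 𝕜 τ τ', _] g := by
  have hγ := isLeast_gammaTilde 𝕜 τ τ' hτ'
  rw [continuous_iff_le_induced]
  -- Refining γ by the initial topology of g leaves its traces on bounded sets unchanged, so
  -- minimality applies.
  suffices h : gammaTilde 𝕜 τ τ' ⊓ .induced g inferInstance ∈
      {γ | IsLCH 𝕜 γ ∧ AgreeOnBdd 𝕜 τ τ' γ} from (hγ.2 h).trans inf_le_right
  refine ⟨⟨?_, ?_, ?_, ?_⟩, ?_⟩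
  · exact topologicalAddGroup_inf hγ.1.1.1 (topologicalAddGroup_induced g)
  · exact @continuousSMul_inf _ _ _ _ _ _ hγ.1.1.2 (continuousSMul_induced g)
  · exact LocallyConvexSpace.inf hγ.1.1.3
      (LocallyConvexSpace.induced (g.restrictScalars ℝ))
  · exact t2Space_antitone inf_le_left hγ.1.1.4
  · intro B hB
    rw [← hγ.1.2 B hB, induced_inf, inf_eq_left, induced_compose, ← continuous_iff_le_induced]
    exact (@continuousOn_iff_continuous_domRestrict X 𝕜 (gammaTilde 𝕜 τ τ') _ g B).1 (hg B hB)

/-- If `τ` is bornological and `τ`-bounded sets are bounded for `gammaTilde 𝕜 τ τ'`, then the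
evaluation map is continuous. -/
theorem continuous_evalMixed [IsScalarTower ℝ 𝕜 X] (hτ : IsLCH 𝕜 τ) (hborn : IsBornological 𝕜 τ)
    (hbdd : ∀ B, IsBdd 𝕜 τ B → IsBdd 𝕜 (gammaTilde 𝕜 τ τ') B) :
    Continuous (evalMixed 𝕜 τ τ') := by
  have : IsTopologicalAddGroup (SpaceWith X τ) := hτ.1
  refine continuous_of_map_add (map_add (evalMixed 𝕜 τ τ')) ?_
  rw [(ContinuousLinearMap.hasBasis_nhds_zero_of_basis Metric.nhds_basis_closedBall).tendsto_right_iff]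
  rintro ⟨H, ε⟩ ⟨hH, hε⟩
  refine hborn {x | ∀ f ∈ H, f x ∈ Metric.closedBall (0 : 𝕜) ε} ⟨?_, ?_⟩ fun B hB => ?_
  · rintro c hc _ ⟨x, hx, rfl⟩ f hf
    have := hx f hf
    rw [mem_closedBall_zero_iff] at this ⊢
    rw [show f (c • x) = c • f x from map_smul f c x, norm_smul]
    exact (mul_le_of_le_one_left (norm_nonneg _) hc).trans this
  · intro x hx y hy a b ha hb hab f hf
    have hsm : ∀ (r : ℝ) (z : X), f (r • z : X) = r • f z := fun r z => by
      rw [← algebraMap_smul 𝕜 r z, ← algebraMap_smul 𝕜 r (f z)]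
      exact map_smul f _ z
    rw [show f (a • x + b • y : X) = f (a • x : X) + f (b • y : X) from map_add f _ _, hsm, hsm]
    exact convex_closedBall (0 : 𝕜) ε (hx f hf) (hy f hf) ha hb hab
  · have himg := ContinuousLinearMap.isVonNBounded_image2_apply hH (hbdd B hB)
      (Metric.closedBall_mem_nhds (0 : 𝕜) hε)
    filter_upwards [himg, eventually_ne_cobounded 0] with c hc hc0 x hx
    rw [Set.mem_smul_set_iff_inv_smul_mem₀ hc0]
    intro f hf
    rw [show f (c⁻¹ • x : X) = c⁻¹ • f x from map_smul f _ x,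
      ← Set.mem_smul_set_iff_inv_smul_mem₀ hc0]
    exact hc ⟨f, hf, x, hx, rfl⟩

/-- If `(X, gammaTilde 𝕜 τ τ')` is semi-reflexive with `τ`-bounded bounded sets, and (CNC) holds,
then the evaluation map is open. -/
theorem isOpenMap_evalMixed [IsScalarTower ℝ 𝕜 X] (hτ : IsLCH 𝕜 τ) (hτ' : IsLCH 𝕜 τ')
    (hCNC : CNC 𝕜 τ τ') (hsr : IsSemiReflexive 𝕜 (SpaceWith X (gammaTilde 𝕜 τ τ')))
    (hbdd : ∀ B, IsBdd 𝕜 (gammaTilde 𝕜 τ τ') B → IsBdd 𝕜 τ B) :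
    IsOpenMap (evalMixed 𝕜 τ τ') := by
  have hγ := isLeast_gammaTilde 𝕜 τ τ' hτ'
  have : IsTopologicalAddGroup (SpaceWith X τ) := hτ.1
  have : IsTopologicalAddGroup (SpaceWith X (gammaTilde 𝕜 τ τ')) := hγ.1.1.1
  have : LocallyConvexSpace ℝ (SpaceWith X (gammaTilde 𝕜 τ τ')) := hγ.1.1.3
  have : IsScalarTower ℝ 𝕜 (SpaceWith X (gammaTilde 𝕜 τ τ')) := ‹IsScalarTower ℝ 𝕜 X›
  refine isOpenMap_of_map_add (map_add (evalMixed 𝕜 τ τ')) ?_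
  intro s hs
  obtain ⟨U, ⟨hU, hUc, hUcl⟩, hUs⟩ := hCNC.mem_iff.1 (mem_map.1 hs)
  have h0 : (0 : X) ∈ U := @mem_of_mem_nhds X τ _ _ hU
  have hUcl' : IsClosed[gammaTilde 𝕜 τ τ'] U :=
    hUcl.mono (hγ.2 ⟨hτ', fun _ _ => rfl⟩)
  let H : Set (StrongDual 𝕜 (SpaceWith X (gammaTilde 𝕜 τ τ'))) := {f | ∀ x ∈ U, ‖f x‖ ≤ 1}
  have hH : IsVonNBounded 𝕜 H := by
    refine ContinuousLinearMap.isVonNBounded_iff.2 fun B hB => ?_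
    -- U absorbs B, and the absorbing scalar c bounds the polar of U on B by ‖c‖.
    obtain ⟨c, hc, hc0⟩ := ((hbdd B hB hU).and (eventually_ne_cobounded 0)).exists
    rw [NormedSpace.isVonNBounded_iff' 𝕜]
    refine ⟨‖c‖, ?_⟩
    rintro _ ⟨f, hf, x, hx, rfl⟩
    obtain ⟨y, hy, hyx⟩ := hc hx
    have hfx : f x = c • f y := (congrArg f hyx.symm).trans (map_smul f c y)
    change ‖f x‖ ≤ ‖c‖
    rw [hfx, norm_smul]
    exact mul_le_of_le_one_right (norm_nonneg _) (hf y hy)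
  refine mem_of_superset (ContinuousLinearMap.eventually_nhds_zero_mapsTo (σ := RingHom.id 𝕜) hH
      (Metric.closedBall_mem_nhds (0 : 𝕜) one_pos)) fun φ hφ => ?_
  obtain ⟨x, rfl⟩ := hsr φ
  refine hUs (a := x) ?_
  by_contra hx
  have hsep := exists_polar_one_lt_norm (𝕜 := 𝕜) (E := SpaceWith X (gammaTilde 𝕜 τ τ')) (C := U)
  obtain ⟨f, hf, hfx⟩ := hsep hUc hUcl' h0 hx
  have : ‖f x‖ ≤ 1 := mem_closedBall_zero_iff.1 (hφ (show f ∈ H from hf))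
  exact hfx.not_ge this

theorem evalMixed_injective [IsScalarTower ℝ 𝕜 X] (hτ' : IsLCH 𝕜 τ') :
    Function.Injective (evalMixed 𝕜 τ τ') := by
  have hγ := isLeast_gammaTilde 𝕜 τ τ' hτ'
  have : IsTopologicalAddGroup (SpaceWith X (gammaTilde 𝕜 τ τ')) := hγ.1.1.1
  have : LocallyConvexSpace ℝ (SpaceWith X (gammaTilde 𝕜 τ τ')) := hγ.1.1.3
  have : IsScalarTower ℝ 𝕜 (SpaceWith X (gammaTilde 𝕜 τ τ')) := ‹IsScalarTower ℝ 𝕜 X›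
  have : T2Space (SpaceWith X (gammaTilde 𝕜 τ τ')) := hγ.1.1.4
  intro x y hxy
  by_contra hne
  obtain ⟨f, hf⟩ := RCLike.geometric_hahn_banach_point_point (𝕜 := 𝕜)
    (E := SpaceWith X (gammaTilde 𝕜 τ τ')) (x := x) (y := y) hne
  exact hf.ne (congrArg RCLike.re (DFunLike.congr_fun hxy f))

end Mixed

end MixedDual

theorem mainTheorem12 {𝕜 : Type*} [RCLike 𝕜] {X : Type*} [AddCommGroup X] [Module 𝕜 X]
    [Module ℝ X] [IsScalarTower ℝ 𝕜 X] (τ τ' : TopologicalSpace X)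
    (hτ : MixedDual.IsLCH 𝕜 τ) (hτ' : MixedDual.IsLCH 𝕜 τ')
    (hborn : MixedDual.IsBornological 𝕜 τ)
    (hBBCl : MixedDual.BBCl 𝕜 τ τ') (hCNC : MixedDual.CNC 𝕜 τ τ')
    (hsr : MixedDual.IsSemiReflexive 𝕜
      (MixedDual.SpaceWith X (MixedDual.gammaTilde 𝕜 τ τ')))
    (hbdd : MixedDual.SameBdd 𝕜 τ (MixedDual.gammaTilde 𝕜 τ τ')) :
    (CompleteSpace (StrongDual 𝕜 (MixedDual.SpaceWith X (MixedDual.gammaTilde 𝕜 τ τ'))) ∧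
      BarrelledSpace 𝕜 (StrongDual 𝕜 (MixedDual.SpaceWith X (MixedDual.gammaTilde 𝕜 τ τ'))) ∧
      MixedDual.IsLCH 𝕜 (inferInstance : TopologicalSpace
        (StrongDual 𝕜 (MixedDual.SpaceWith X (MixedDual.gammaTilde 𝕜 τ τ'))))) ∧
    IsHomeomorph (MixedDual.evalMixed 𝕜 τ τ') ∧
    MixedDual.IsPrebidual 𝕜 τ (MixedDual.gammaTilde 𝕜 τ τ') (MixedDual.evalMixed 𝕜 τ τ') ∧
    MixedDual.IsSemiReflexive 𝕜
      (MixedDual.SpaceWith X (MixedDual.gammaTilde 𝕜 τ τ')) := by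
  have hγ := (MixedDual.isLeast_gammaTilde 𝕜 τ τ' hτ').1.1
  have : IsTopologicalAddGroup (MixedDual.SpaceWith X (MixedDual.gammaTilde 𝕜 τ τ')) := hγ.1
  have : LocallyConvexSpace ℝ (MixedDual.SpaceWith X (MixedDual.gammaTilde 𝕜 τ τ')) := hγ.3
  have : IsScalarTower ℝ 𝕜 (MixedDual.SpaceWith X (MixedDual.gammaTilde 𝕜 τ τ')) :=
    ‹IsScalarTower ℝ 𝕜 X›
  have hhomeo : IsHomeomorph (MixedDual.evalMixed 𝕜 τ τ') :=
    ⟨MixedDual.continuous_evalMixed hτ hborn fun B => (hbdd B).1,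
      MixedDual.isOpenMap_evalMixed hτ hτ' hCNC hsr fun B => (hbdd B).2,
      MixedDual.evalMixed_injective hτ', hsr⟩
  refine ⟨⟨?_, hsr.barrelledSpace_strongDual, ?_⟩, hhomeo, ⟨hγ, hhomeo⟩, hsr⟩
  · exact MixedDual.completeSpace_strongDual fun g hg =>
      MixedDual.continuous_gammaTilde_of_continuousOn hτ' g fun B hB => hg B ((hbdd B).1 hB)
  · exact ⟨inferInstance, inferInstance, inferInstance, inferInstance⟩
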